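/- **Conventions.** A Hausdorff space $X$ is a $k_\omega$-space if there are compact subsets $K_1\subseteq K_2\subseteq\cdots$ with $X=\bigcup_n K_n$ such that $U\subseteq X$ is open if and only if $U\cap K_n$ is open in $K_n$ for all $n$; $X$ is locally $k_\omega$ if it is Hausdorff and each point has an open neighbourhood which is a $k_\omega$-space in the induced topology. A topological group is called locally $k_\omega$ if its underlying space is so. Let $\mathbb T=\{z\in\mathbb C: |z|=1\}$. For a topological abelian group $G$, let $G^*$ be the group of continuous homomorphisms $G\to\mathbb T$ with the compact-open topology; for a continuous homomorphism $f\colon G\to H$ let $f^*\colon H^*\to G^*$, $f^*(\xi)=\xi\circ f$. The group $G$ is reflexive if $\eta_G\colon G\to G^{**}$, $\eta_G(x)(\xi)=\xi(x)$, is an isomorphism of topological groups. With $\mathbb T_+=\{z\in\mathbb T:\operatorname{Re} z\ge 0\}$, the polar of $A\subseteq G$ is $A^\circ=\{\xi\in G^*:\xi(A)\subseteq\mathbb T_+\}$, and that of $B\subseteq G^*$ is ${}^\circ B=\eta_G^{-1}(B^\circ)\subseteq G$. The group $G$ is locally quasi-convex if its identity element has a basis of neighbourhoods $U$ with $U={}^\circ(U^\circ)$.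 Let $\mathcal O_{\mathrm{lqc}}$ be the finest locally quasi-convex group topology on $G$ coarser than the given topology, let $G_{\mathrm{lqc}}$ be the quotient of $(G,\mathcal O_{\mathrm{lqc}})$ by the closure of its trivial subgroup, and let $\gamma\colon G\to G_{\mathrm{lqc}}$ be the canonical homomorphism. A subgroup $H$ of $G$ is dually embedded if each continuous homomorphism $H\to\mathbb T$ extends to a continuous homomorphism $G\to\mathbb T$. **Proposition.** Let $((G_n)_{n\in\mathbb N},(i_{n,m})_{n\ge m})$ be a direct sequence of abelian, locally $k_\omega$ groups and continuous homomorphisms $i_{n,m}\colon G_m\to G_n$, and let $(G,(i_n)_{n\in\mathbb N})$ be its direct limit in the category of Hausdorff abelian topological groups. (a) $(G^*,(i_n^*)_{n\in\mathbb N})$ is the projective limit of $((G_n^*)_{n\in\mathbb N},(i_{n,m}^*)_{n\ge m})$ as a topological group; that is, $\xi\mapsto(i_n^*(\xi))_{n}$ is an isomorphism of topological groups from $G^*$ onto the group of all $(\xi_n)_n\in\prod_n G_n^*$ such that $i_{n,m}^*(\xi_n)=\xi_m$ for all $n\ge m$, equipped with the topology induced by the product topology. (b) If each $G_n$ is reflexive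 and each $i_n^*\colon G^*\to G_n^*$ has dense image, then $G_{\mathrm{lqc}}$ is reflexive and $\gamma^*\colon (G_{\mathrm{lqc}})^*\to G^*$ is an isomorphism of topological groups. The condition that each $i_n^*$ has dense image is satisfied, for example, if $i_{n,m}$ is a topological embedding and $i_{n,m}(G_m)$ is dually embedded in $G_n$ for all $m\le n$. -/

import Mathlib

open Topology

universe u

/-! ### `k_ω`-spaces and locally `k_ω` spaces -/

/-- A Hausdorff space `X` is a `k_ω`-space if it is the direct limit, as a topological space, of an
ascending sequence of compact subsets covering it. -/
def IsKOmegaSpace (X : Type*) [TopologicalSpace X] : Prop :=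
  T2Space X ∧ ∃ K : ℕ → Set X, Monotone K ∧ (∀ n, IsCompact (K n)) ∧ (⋃ n, K n) = Set.univ ∧
    ∀ U : Set X, IsOpen U ↔ ∀ n, IsOpen ((↑) ⁻¹' U : Set (K n))

/-- A Hausdorff space is locally `k_ω` if each point has an open neighbourhood which is a
`k_ω`-space in the induced topology. -/
def IsLocallyKOmegaSpace (X : Type*) [TopologicalSpace X] : Prop :=
  T2Space X ∧ ∀ x : X, ∃ U : Set X, IsOpen U ∧ x ∈ U ∧ IsKOmegaSpace U

/-! ### Direct limits and projective limits -/

/-- `(G, (ι n))` is a direct limit of the direct sequence `(A, i)` in the category of Hausdorff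
abelian topological groups and continuous homomorphisms. -/
structure IsHausdorffDirectLimit {A : ℕ → Type u} [∀ n, CommGroup (A n)]
    [∀ n, TopologicalSpace (A n)] (i : ∀ m n, m ≤ n → (A m →ₜ* A n))
    (G : Type u) [CommGroup G] [TopologicalSpace G] (ι : ∀ n, A n →ₜ* G) : Prop where
  isTopologicalGroup : IsTopologicalGroup G
  t2Space : T2Space G
  comp_eq : ∀ m n (h : m ≤ n), (ι n).comp (i m n h) = ι m
  existsUnique_desc : ∀ (H : Type u) [CommGroup H] [TopologicalSpace H] [IsTopologicalGroup H]
    [T2Space H] (ψ : ∀ n, A n →ₜ* H), (∀ m n (h : m ≤ n), (ψ n).comp (i m n h) = ψ m) →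
    ∃! φ : G →ₜ* H, ∀ n, φ.comp (ι n) = ψ n

/-- The projective limit of a projective sequence `(B, p)` of abelian topological groups: the
group of compatible families, with the topology induced by the product topology. -/
def projectiveLimit (B : ℕ → Type*) [∀ n, CommGroup (B n)] [∀ n, TopologicalSpace (B n)]
    (p : ∀ m n, m ≤ n → (B n →ₜ* B m)) : Subgroup (∀ n, B n) where
  carrier := {b | ∀ m n (h : m ≤ n), p m n h (b n) = b m}
  one_mem' := fun m n h => by simp
  mul_mem' := fun {a b} ha hb m n h => by simp [ha m n h, hb m n h]
  inv_mem' := fun {a} ha m n h => by simp [ha m n h]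

/-! ### Pontryagin duality -/

section Duality

variable (G : Type*) [CommGroup G] [TopologicalSpace G]

/-- The evaluation homomorphism `η_G : G → G**`, `η_G(x)(ξ) = ξ(x)`. -/
noncomputable def dualEval : G →* PontryaginDual (PontryaginDual G) where
  toFun x :=
    { toFun := fun ξ => ξ x
      map_one' := rfl
      map_mul' := fun _ _ => rfl
      continuous_toFun :=
        (ContinuousEvalConst.continuous_eval_const x : Continuous fun ξ : G →ₜ* Circle => ξ x) }
  map_one' := by ext ξ; exact congrArg _ (map_one ξ)
  map_mul' x y := by ext ξ; exact congrArg _ (map_mul ξ x y)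

/-- `G` is reflexive if `η_G` is an isomorphism of topological groups (since `G**` is Hausdorff,
such a `G` is Hausdorff). -/
def IsReflexive : Prop := IsHomeomorph (dualEval G)

variable {G}

/-- The polar `A° = {ξ ∈ G* | ξ(A) ⊆ 𝕋₊}`, where `𝕋₊ = {z ∈ 𝕋 | 0 ≤ Re z}`. -/
def polar (A : Set G) : Set (PontryaginDual G) :=
  {ξ | ∀ x ∈ A, 0 ≤ (ξ x : ℂ).re}

/-- The polar `°B = η_G⁻¹(B°)` in `G` of a subset `B` of `G*`. -/
def prepolar (B : Set (PontryaginDual G)) : Set G := dualEval G ⁻¹' polar B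

theorem mem_prepolar_polar {A : Set G} {x : G} :
    x ∈ prepolar (polar A) ↔
      ∀ ξ : PontryaginDual G, (∀ a ∈ A, 0 ≤ (ξ a : ℂ).re) → 0 ≤ (ξ x : ℂ).re := Iff.rfl

theorem subset_prepolar_polar (A : Set G) : A ⊆ prepolar (polar A) :=
  fun x hx => mem_prepolar_polar.2 fun _ hξ => hξ x hx

theorem prepolar_polar_mono {A B : Set G} (h : A ⊆ B) :
    prepolar (polar A) ⊆ prepolar (polar B) :=
  fun _ hx ξ hξ => hx ξ fun a ha => hξ a (h ha)

theorem prepolar_polar_idem (A : Set G) :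
    prepolar (polar (prepolar (polar A))) = prepolar (polar A) :=
  (Set.Subset.antisymm (subset_prepolar_polar _)
    fun _ hx => mem_prepolar_polar.2 fun ξ hξ => hx ξ fun _ ha => ha ξ hξ).symm

/-- A subgroup `H` of `G` is dually embedded if each character of `H` extends to `G`. -/
def IsDuallyEmbedded (H : Subgroup G) : Prop :=
  ∀ ξ : PontryaginDual H, ∃ θ : PontryaginDual G, ∀ x : H, θ x = ξ x

variable (G)

/-- `G` is locally quasi-convex if the neighbourhoods `U` of the neutral element with
`U = °(U°)` form a basis of neighbourhoods of it. -/
def IsLocallyQuasiConvex : Prop :=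
  (𝓝 (1 : G)).HasBasis (fun U => U ∈ 𝓝 (1 : G) ∧ U = prepolar (polar U)) id

theorem isLocallyQuasiConvex_iff :
    IsLocallyQuasiConvex G ↔ ∀ W ∈ 𝓝 (1 : G), ∃ U ∈ 𝓝 (1 : G), prepolar (polar U) ⊆ W := by
  constructor
  · intro h W hW
    obtain ⟨U, ⟨hU, hUU⟩, hUW⟩ := h.mem_iff.1 hW
    exact ⟨U, hU, hUU ▸ hUW⟩
  · refine fun h => ⟨fun W => ⟨fun hW => ?_, ?_⟩⟩
    · obtain ⟨U, hU, hUW⟩ := h W hW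
      exact ⟨_, ⟨Filter.mem_of_superset hU (subset_prepolar_polar U),
        (prepolar_polar_idem U).symm⟩, hUW⟩
    · rintro ⟨U, ⟨hU, -⟩, hUW⟩
      exact Filter.mem_of_superset hU hUW

end Duality

/-! ### The locally quasi-convex group associated with a topological abelian group -/

/-- The topology `𝒪_lqc`: the finest locally quasi-convex group topology on `G` which is coarser
than the given topology `t`. (For topologies, `t ≤ s` means that `s` is coarser than `t`, and the
infimum is the topology generated by all members; that it has the properties required of the
members is `lqcTopology_mem`.) -/
@[reducible] def lqcTopology (G : Type*) [CommGroup G] [t : TopologicalSpace G] : TopologicalSpace G :=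
  sInf {s | t ≤ s ∧ @IsTopologicalGroup G s _ ∧ @IsLocallyQuasiConvex G _ s}

theorem lqcTopology_mem (G : Type*) [CommGroup G] [t : TopologicalSpace G] :
    lqcTopology G ∈
      {s | t ≤ s ∧ @IsTopologicalGroup G s _ ∧ @IsLocallyQuasiConvex G _ s} := by
  refine ⟨le_sInf fun s hs => hs.1, topologicalGroup_sInf fun s hs => hs.2.1, ?_⟩
  rw [@isLocallyQuasiConvex_iff G _ (@lqcTopology G _ t)]
  intro W hW
  have hn : @nhds G (@lqcTopology G _ t) 1 = _ := nhds_sInf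
  rw [iInf_subtype'] at hn
  rw [hn] at hW ⊢
  refine Filter.iInf_sets_induct hW ⟨Set.univ, Filter.univ_mem, Set.subset_univ _⟩ ?_
  rintro ⟨s, hs⟩ W₁ W₂ hW₁ ⟨U₂, hU₂, hUW₂⟩
  obtain ⟨U₁, hU₁, hUW₁⟩ := (@isLocallyQuasiConvex_iff G _ s).1 hs.2.2 W₁ hW₁
  refine ⟨U₁ ∩ U₂, Filter.inter_mem (Filter.mem_iInf_of_mem ⟨s, hs⟩ hU₁) hU₂,
    Set.subset_inter (fun x hx => hUW₁ ?_) fun x hx => hUW₂ ?_⟩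
  · intro ξ hξ
    let ξ' : @PontryaginDual G _ (@lqcTopology G _ t) :=
      @ContinuousMonoidHom.mk G Circle _ _ (@lqcTopology G _ t) _
        (@ContinuousMonoidHom.toMonoidHom G Circle _ _ s _ ξ)
        (continuous_le_dom (show @lqcTopology G _ t ≤ s from sInf_le hs)
          (@ContinuousMonoidHom.continuous_toFun G Circle _ _ s _ ξ))
    exact hx ξ' fun a ha => hξ a ha.1
  · exact fun ξ hξ => hx ξ fun a ha => hξ a ha.2

/-- The group `G`, equipped with the topology `𝒪_lqc`. -/
def WithLqcTopology (G : Type*) : Type _ := G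

section Lqc

variable (G : Type*) [CommGroup G] [TopologicalSpace G]

instance : CommGroup (WithLqcTopology G) := inferInstanceAs (CommGroup G)

instance : TopologicalSpace (WithLqcTopology G) := lqcTopology G

instance : IsTopologicalGroup (WithLqcTopology G) := (lqcTopology_mem G).2.1

/-- `G_lqc`, the quotient of `(G, 𝒪_lqc)` by the closure of the trivial subgroup. -/
abbrev Lqc : Type _ :=
  WithLqcTopology G ⧸ (⊥ : Subgroup (WithLqcTopology G)).topologicalClosure

/-- The canonical homomorphism `γ : G → G_lqc`. -/
def toLqc : G →ₜ* Lqc G where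
  toFun x := QuotientGroup.mk (s := (⊥ : Subgroup (WithLqcTopology G)).topologicalClosure) x
  map_one' := rfl
  map_mul' _ _ := rfl
  continuous_toFun :=
    (QuotientGroup.continuous_mk (N := (⊥ : Subgroup (WithLqcTopology G)).topologicalClosure)).comp
      (continuous_id_iff_le.2 (lqcTopology_mem G).1)

end Lqc

/-! ### The quarter conditions `0 ≤ Re z` on the circle group -/

/-! Everything rests on a countable exhaustion near `1`: an ascending sequence of compact sets whose
union is an open neighbourhood of `1` carrying the direct limit topology
(`IsKOmegaExhaustionAtOne`). Each group of the sequence has one, and they combine into one for `G`.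
By a compactness argument the final topology on `G` is already a group topology, so the universal
property forces it to be the given one. Consequently every compact subset of `G` is the image of a
compact subset of a single `A n` (`IsHausdorffDirectLimit.exists_isCompact_image_eq`). Hence a basic
condition on a character of `G` involves only one component, which is the topological half of the
projective limit statement.

For reflexivity, the exhaustion makes both `η_G` and `η_{G*}` continuous, the second through Ascoli
and a diagonal sequence of characters. A character of `G*` is small on the polar of a compact set
lifted to some `A n`; by density it descends to a character of `(A n)*`, which reflexivity turns
into a point. So `η_G` is onto. Since `𝒪_lqc` is the topology induced by `η_G`, it follows that
`G_lqc ≅ G**`, and the identity `(η_G)* ∘ η_{G*} = id` yields the rest. -/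

theorem Circle.continuous_re : Continuous fun z : Circle => (z : ℂ).re :=
  Complex.continuous_re.comp continuous_subtype_val

theorem Circle.sq_re_add_sq_im (z : Circle) : (z : ℂ).re ^ 2 + (z : ℂ).im ^ 2 = 1 := by
  have h := Circle.normSq_coe z
  rw [Complex.normSq_apply] at h
  nlinarith

/-- Squaring at least doubles `1 - Re z` while `0 ≤ Re z`, because `1 - Re z² = 2 (1 - Re z) (1 + Re
z)`. -/
theorem Circle.one_sub_re_le_of_forall_pow (m : ℕ) :
    ∀ z : Circle, (∀ j ≤ m, 0 ≤ ((z ^ 2 ^ j : Circle) : ℂ).re) →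
      1 - (z : ℂ).re ≤ (1 / 2) ^ m := by
  induction m with
  | zero => intro z hz; simpa using hz 0 le_rfl
  | succ m ih =>
    intro z hz
    have h := ih (z ^ 2) fun j hj => by
      rw [← pow_mul, ← pow_succ']
      exact hz (j + 1) (by omega)
    have h0 : 0 ≤ (z : ℂ).re := by simpa using hz 0 (Nat.zero_le _)
    have h1 := Circle.sq_re_add_sq_im z
    have h2 : ((z ^ 2 : Circle) : ℂ).re = (z : ℂ).re ^ 2 - (z : ℂ).im ^ 2 := by
      simp [pow_two]
    rw [h2] at h
    rw [pow_succ]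
    nlinarith

theorem Circle.exists_pow_imp_mem {W : Set Circle} (hW : W ∈ 𝓝 (1 : Circle)) :
    ∃ m : ℕ, ∀ z : Circle, (∀ j ≤ m, 0 ≤ ((z ^ 2 ^ j : Circle) : ℂ).re) → z ∈ W := by
  obtain ⟨ε, hε, hεW⟩ := Metric.mem_nhds_iff.1 hW
  -- The bound `ε² / 2` comes from `|z - 1|² = 2 (1 - Re z)` on the circle.
  obtain ⟨m, hm⟩ := exists_pow_lt_of_lt_one (show 0 < ε ^ 2 / 2 by positivity)
    (show (1 / 2 : ℝ) < 1 by norm_num)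
  refine ⟨m, fun z hz => hεW ?_⟩
  have h := Circle.one_sub_re_le_of_forall_pow m z hz
  have h1 := Circle.sq_re_add_sq_im z
  rw [Metric.mem_ball]
  change dist (z : ℂ) ((1 : Circle) : ℂ) < ε
  rw [Complex.dist_eq, ← sq_lt_sq₀ (norm_nonneg _) hε.le,
    ← Complex.normSq_eq_norm_sq, Complex.normSq_apply]
  have h2 : ((z : ℂ) - ((1 : Circle) : ℂ)).re = (z : ℂ).re - 1 := by simp
  have h3 : ((z : ℂ) - ((1 : Circle) : ℂ)).im = (z : ℂ).im := by simp
  change ((z : ℂ) - ((1 : Circle) : ℂ)).re * ((z : ℂ) - ((1 : Circle) : ℂ)).re +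
    ((z : ℂ) - ((1 : Circle) : ℂ)).im * ((z : ℂ) - ((1 : Circle) : ℂ)).im < ε ^ 2
  rw [h2, h3]
  nlinarith

theorem Circle.setOf_re_pos_mem_nhds : {z : Circle | 0 < (z : ℂ).re} ∈ 𝓝 (1 : Circle) :=
  (isOpen_lt continuous_const Circle.continuous_re).mem_nhds (by simp)

/-! ### Polars and the topology of the dual -/

section Polar

variable {G : Type*} [CommGroup G] [TopologicalSpace G]

/-- A character, as a continuous map. -/
noncomputable def PontryaginDual.toContinuousMap (ξ : PontryaginDual G) : C(G, Circle) :=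
  ⟨ξ, map_continuous ξ⟩

theorem PontryaginDual.isInducing_toContinuousMap :
    IsInducing (PontryaginDual.toContinuousMap : PontryaginDual G → C(G, Circle)) :=
  ContinuousMonoidHom.isInducing_toContinuousMap G Circle

theorem isClosed_polar (A : Set G) : IsClosed (polar A) := by
  have : polar A = ⋂ x ∈ A, {ξ : PontryaginDual G | 0 ≤ (ξ x : ℂ).re} := by
    ext; simp [polar]
  rw [this]
  exact isClosed_biInter fun x _ => isClosed_le continuous_const
    (Circle.continuous_re.comp (map_continuous (dualEval G x)))

theorem polar_anti {A B : Set G} (h : A ⊆ B) : polar B ⊆ polar A :=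
  fun _ hξ x hx => hξ x (h hx)

theorem polar_mem_nhds_one {K : Set G} (hK : IsCompact K) :
    polar K ∈ 𝓝 (1 : PontryaginDual G) := by
  have h : IsOpen {f : C(G, Circle) | Set.MapsTo f K {z | 0 < (z : ℂ).re}} :=
    ContinuousMap.isOpen_setOfPred_mapsTo hK (isOpen_lt continuous_const Circle.continuous_re)
  refine Filter.mem_of_superset ((h.preimage
    PontryaginDual.isInducing_toContinuousMap.continuous).mem_nhds ?_) ?_
  · intro x _
    change 0 < (((1 : PontryaginDual G) x : Circle) : ℂ).re
    simp
  · exact fun ξ hξ x hx => le_of_lt (hξ hx)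

theorem exists_polar_subset_setOf_mapsTo [ContinuousMul G] {K : Set G} (hK : IsCompact K)
    {W : Set Circle} (hW : W ∈ 𝓝 (1 : Circle)) :
    ∃ C : Set G, IsCompact C ∧ polar C ⊆ {ξ : PontryaginDual G | ∀ x ∈ K, ξ x ∈ W} := by
  obtain ⟨m, hm⟩ := Circle.exists_pow_imp_mem hW
  refine ⟨⋃ j ∈ Finset.range (m + 1), (fun x => x ^ 2 ^ j) '' K,
    Finset.isCompact_biUnion _ fun j _ => hK.image (continuous_pow _), fun ξ hξ x hx =>
    hm _ fun j hj => ?_⟩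
  rw [← map_pow]
  exact hξ _ (Set.mem_biUnion (Finset.mem_range.2 (by omega)) ⟨x, hx, rfl⟩)

/-- Together with `polar_mem_nhds_one`, this replaces the compact-open topology at `1` by polars of
compact sets. -/
theorem exists_polar_subset [ContinuousMul G] {W : Set (PontryaginDual G)}
    (hW : W ∈ 𝓝 (1 : PontryaginDual G)) : ∃ K : Set G, IsCompact K ∧ polar K ⊆ W := by
  rw [PontryaginDual.isInducing_toContinuousMap.nhds_eq_comap, Filter.mem_comap] at hW
  obtain ⟨V, hV, hVW⟩ := hW
  obtain ⟨S, hS, hSo, hSV⟩ := ContinuousMap.mem_nhds_iff.1 hV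
  have h : ∀ p ∈ S, ∃ C : Set G, IsCompact C ∧
      polar C ⊆ {ξ : PontryaginDual G | ∀ x ∈ p.1, ξ x ∈ p.2} := by
    rintro ⟨K, U⟩ hp
    obtain ⟨hK, hU, h1⟩ := hSo K U hp
    -- Only a nonempty `K` forces `1 ∈ U`, through the trivial character.
    rcases K.eq_empty_or_nonempty with rfl | ⟨x, hx⟩
    · exact ⟨∅, isCompact_empty, fun ξ _ x hx => hx.elim⟩
    · exact exists_polar_subset_setOf_mapsTo hK (hU.mem_nhds (h1 hx))
  choose! C hC hCS using h
  refine ⟨⋃ p ∈ S, C p, hS.isCompact_biUnion hC, fun ξ hξ => hVW (hSV ?_)⟩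
  intro K U hp x hx
  exact hCS _ hp (polar_anti (Set.subset_biUnion_of_mem hp) hξ) x hx

/-- The polar of a neighbourhood of the neutral element is compact. -/
theorem isCompact_polar [IsTopologicalGroup G] {U : Set G} (hU : U ∈ 𝓝 (1 : G)) :
    IsCompact (polar U) := by
  rw [PontryaginDual.isInducing_toContinuousMap.isCompact_iff]
  have heq : Equicontinuous (fun f : {f : G →* Circle | ∀ x ∈ U, 0 ≤ (f x : ℂ).re} =>
      (f : G → Circle)) := by
    refine equicontinuous_of_equicontinuousAt_one _ ?_
    rw [(Filter.basis_sets _).uniformity_of_nhds_one.equicontinuousAt_iff_right]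
    intro W hW
    obtain ⟨m, hm⟩ := Circle.exists_pow_imp_mem hW
    have h : ∀ᶠ x in 𝓝 (1 : G), ∀ j ∈ Finset.range (m + 1), x ^ 2 ^ j ∈ U := by
      rw [Filter.eventually_all_finset]
      exact fun j _ => (continuous_pow (2 ^ j)).continuousAt.eventually_mem (by simpa using hU)
    filter_upwards [h] with x hx f
    change (f : G →* Circle) x / (f : G →* Circle) 1 ∈ W
    rw [map_one, div_one]
    refine hm _ fun j hj => ?_
    rw [← map_pow]
    exact f.2 _ (hx j (Finset.mem_range.2 (by omega)))
  refine ArzelaAscoli.isCompact_of_equicontinuous _ ?_ ?_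
  · have h : ContinuousMap.toFun '' (PontryaginDual.toContinuousMap '' polar U) =
        Set.range (DFunLike.coe : (G →* Circle) → G → Circle) ∩
          ⋂ x ∈ U, {f : G → Circle | 0 ≤ (f x : ℂ).re} := by
      ext f
      simp only [Set.mem_inter_iff, Set.mem_iInter]
      constructor
      · rintro ⟨-, ⟨ξ, hξ, rfl⟩, rfl⟩
        exact ⟨⟨ContinuousMonoidHom.toMonoidHom ξ, rfl⟩, hξ⟩
      · rintro ⟨⟨f, rfl⟩, hf⟩
        -- A homomorphism into `𝕋` that maps `U` into `𝕋₊` is automatically continuous, so the polar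
        -- is closed in the full product.
        have hfc : Continuous f := heq.continuous ⟨f, hf⟩
        exact ⟨_, ⟨(⟨f, hfc⟩ : G →ₜ* Circle), hf, rfl⟩, rfl⟩
    rw [h]
    exact ((MonoidHom.isClosed_range_coe G Circle).inter (isClosed_biInter fun x _ =>
      isClosed_le continuous_const (Circle.continuous_re.comp (continuous_apply x)))).isCompact
  · have h : ∀ f : PontryaginDual.toContinuousMap '' polar U,
        ∃ g : {f : G →* Circle | ∀ x ∈ U, 0 ≤ (f x : ℂ).re},
          ((g : G →* Circle) : G → Circle) = (f : C(G, Circle)) := by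
      rintro ⟨-, ξ, hξ, rfl⟩
      exact ⟨⟨ContinuousMonoidHom.toMonoidHom ξ, hξ⟩, rfl⟩
    choose g hg using h
    convert heq.comp g using 1
    funext f
    exact (hg f).symm

/-- Evaluation is jointly continuous on `L × K`, and projecting along the compact factor `L` is a
closed map. -/
theorem isOpen_setOf_forall_re_pos [IsTopologicalGroup G] {L : Set (PontryaginDual G)}
    (hL : IsCompact L) {K : Set G} (hK : IsCompact K) :
    IsOpen {x : K | ∀ ξ ∈ L, 0 < (ξ x : ℂ).re} := by
  have := isCompact_iff_compactSpace.1 hL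
  have := isCompact_iff_compactSpace.1 hK
  have hc : Continuous fun p : L × K => (((p.1 : PontryaginDual G) p.2 : Circle) : ℂ).re := by
    have hr : Continuous fun ξ : L =>
        (PontryaginDual.toContinuousMap (ξ : PontryaginDual G)).restrict K :=
      (ContinuousMap.continuous_restrict K).comp
        (PontryaginDual.isInducing_toContinuousMap.continuous.comp continuous_subtype_val)
    exact Circle.continuous_re.comp (continuous_eval.comp
      ((hr.comp continuous_fst).prodMk continuous_snd))
  have h := isClosedMap_snd_of_compactSpace _ (isClosed_le hc continuous_const : IsClosed {p : L × K | _ ≤ (0 : ℝ)})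
  rw [← isOpen_compl_iff] at h
  convert h using 1
  ext x
  simp

theorem continuous_dualEval_of_prepolar_mem [IsTopologicalGroup G]
    (h : ∀ L : Set (PontryaginDual G), IsCompact L → prepolar L ∈ 𝓝 (1 : G)) :
    Continuous (dualEval G) := by
  refine continuous_of_continuousAt_one _ fun W hW => ?_
  rw [map_one] at hW
  obtain ⟨L, hL, hLW⟩ := exists_polar_subset hW
  exact Filter.mem_of_superset (h L hL) (Set.preimage_mono hLW)

end Polar

/-! ### Groups whose topology is determined by compact sets near the neutral element -/

/-- The ascending sequence of compact sets `B n` covers a neighbourhood of the neutral element, and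
its union is an open set which is the direct limit, as a topological space, of these compact
sets. -/
structure IsKOmegaExhaustionAtOne {G : Type*} [CommGroup G] [TopologicalSpace G]
    (B : ℕ → Set G) : Prop where
  monotone : Monotone B
  isCompact : ∀ n, IsCompact (B n)
  one_mem : (1 : G) ∈ ⋃ n, B n
  isOpen : ∀ O ⊆ ⋃ n, B n, (∀ n, IsOpen ((↑) ⁻¹' O : Set (B n))) → IsOpen O

section

variable {G : Type*} [CommGroup G] [TopologicalSpace G] {B : ℕ → Set G}

theorem setOf_forall_re_pos_mem_nhds_one [IsTopologicalGroup G] {K : Set G} (hK : IsCompact K) :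
    {ξ : PontryaginDual G | ∀ x ∈ K, 0 < (ξ x : ℂ).re} ∈ 𝓝 1 := by
  obtain ⟨C, hC, hCK⟩ := exists_polar_subset_setOf_mapsTo hK Circle.setOf_re_pos_mem_nhds
  exact Filter.mem_of_superset (polar_mem_nhds_one hC) hCK

namespace IsKOmegaExhaustionAtOne

theorem prepolar_mem_nhds_one [IsTopologicalGroup G] (hB : IsKOmegaExhaustionAtOne B) {L : Set (PontryaginDual G)}
    (hL : IsCompact L) : prepolar L ∈ 𝓝 (1 : G) := by
  have hO : IsOpen {x | x ∈ ⋃ n, B n ∧ ∀ ξ ∈ L, 0 < (ξ x : ℂ).re} := by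
    refine hB.isOpen _ (fun x hx => hx.1) fun n => ?_
    convert isOpen_setOf_forall_re_pos hL (hB.isCompact n) using 1
    ext x
    exact ⟨fun h => h.2, fun h => ⟨Set.mem_iUnion_of_mem n x.2, h⟩⟩
  refine Filter.mem_of_superset (hO.mem_nhds ⟨hB.one_mem, fun ξ _ => by simp⟩) ?_
  exact fun x hx ξ hξ => (hx.2 ξ hξ).le

theorem continuous_dualEval [IsTopologicalGroup G] (hB : IsKOmegaExhaustionAtOne B) : Continuous (dualEval G) :=
  continuous_dualEval_of_prepolar_mem fun _ hL => hB.prepolar_mem_nhds_one hL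

/-- A sequence of characters which is eventually small on each of the compact sets is
equicontinuous. -/
theorem exists_nhds_forall_mem_polar (hB : IsKOmegaExhaustionAtOne B)
    {ξ : ℕ → PontryaginDual G} (hξ : ∀ n, ∀ x ∈ B n, 0 < (ξ n x : ℂ).re) :
    ∃ V ∈ 𝓝 (1 : G), ∀ n, ξ n ∈ polar V := by
  have hO : IsOpen {x | x ∈ ⋃ n, B n ∧ ∀ n, 0 < (ξ n x : ℂ).re} := by
    refine hB.isOpen _ (fun x hx => hx.1) fun m => ?_
    -- On `B m` only the first `m` characters impose a condition; the later ones satisfy it by `hξ`.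
    have h : IsOpen (⋂ n ∈ Finset.range m, {x : B m | 0 < (ξ n x : ℂ).re}) :=
      isOpen_biInter_finset fun n _ => isOpen_lt continuous_const
        (Circle.continuous_re.comp ((map_continuous (ξ n)).comp continuous_subtype_val))
    convert h using 1
    ext x
    simp only [Set.mem_iInter, Finset.mem_range]
    refine ⟨fun h n _ => h.2 n, fun h => ⟨Set.mem_iUnion_of_mem m x.2, fun n => ?_⟩⟩
    rcases lt_or_ge n m with hn | hn
    · exact h n hn
    · exact hξ n x (hB.monotone hn x.2)
  exact ⟨_, hO.mem_nhds ⟨hB.one_mem, fun n => by simp⟩, fun n x hx => (hx.2 n).le⟩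

theorem iUnion_mem_nhds (hB : IsKOmegaExhaustionAtOne B) : (⋃ n, B n) ∈ 𝓝 (1 : G) := by
  refine (hB.isOpen _ subset_rfl fun n => ?_).mem_nhds hB.one_mem
  convert isOpen_univ
  exact Set.eq_univ_of_forall fun x => Set.mem_iUnion_of_mem n x.2

/-- Otherwise there are characters `ξ n` close to `1`, small on `B n`, and outside the prepolar of
`L`. They are equicontinuous, so they cluster at some `θ` in a compact polar. This `θ` lies in the
polar of the whole exhaustion and is still close to `1`, so `L` is strictly positive at `θ`, hence
at some `ξ n`. -/
theorem prepolar_mem_nhds_one_dual [IsTopologicalGroup G] (hB : IsKOmegaExhaustionAtOne B)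
    {L : Set (PontryaginDual (PontryaginDual G))} (hL : IsCompact L) :
    prepolar L ∈ 𝓝 (1 : PontryaginDual G) := by
  have key : ∀ P : Set (PontryaginDual G), IsCompact P → ∀ θ ∈ P,
      (∀ χ ∈ L, 0 < (χ θ : ℂ).re) →
        ∃ W ∈ 𝓝 θ, ∀ ξ ∈ W, ξ ∈ P → ∀ χ ∈ L, 0 < (χ ξ : ℂ).re := by
    intro P hP θ hθ hθL
    obtain ⟨W, hW, hWP⟩ := mem_nhds_subtype P ⟨θ, hθ⟩ _ |>.1
      ((isOpen_setOf_forall_re_pos hL hP).mem_nhds (show _ from hθL))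
    exact ⟨W, hW, fun ξ hξW hξ => hWP (show (⟨ξ, hξ⟩ : P).1 ∈ W from hξW)⟩
  obtain ⟨W, hW, hWL⟩ := key _ (isCompact_polar hB.iUnion_mem_nhds) 1
    (fun x _ => by simp) (fun χ _ => by simp)
  -- Closedness of `W'` keeps the cluster point inside `W`.
  obtain ⟨W', ⟨hW', hW'c⟩, hWW'⟩ := (closed_nhds_basis (1 : PontryaginDual G)).mem_iff.1 hW
  by_contra hcon
  have h : ∀ n, ∃ ξ : PontryaginDual G, (∀ x ∈ B n, 0 < (ξ x : ℂ).re) ∧ ξ ∈ W' ∧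
      ξ ∉ prepolar L := by
    intro n
    by_contra! h
    exact hcon (Filter.mem_of_superset
      (Filter.inter_mem (setOf_forall_re_pos_mem_nhds_one (hB.isCompact n)) hW')
      fun ξ hξ => h ξ hξ.1 hξ.2)
  choose ξ hξB hξW hξL using h
  obtain ⟨V, hV, hξV⟩ := hB.exists_nhds_forall_mem_polar hξB
  obtain ⟨θ, hθV, hθ⟩ := (isCompact_polar hV).exists_mapClusterPt (f := Filter.atTop) (u := ξ)
    (Filter.tendsto_principal.2 (Filter.Eventually.of_forall hξV))
  have hclosed : ∀ F : Set (PontryaginDual G), IsClosed F → (∀ᶠ n in Filter.atTop, ξ n ∈ F) →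
      θ ∈ F := fun F hF hFe => by
    by_contra hn
    obtain ⟨n, hn1, hn2⟩ := ((hθ.frequently (hF.isOpen_compl.mem_nhds hn)).and_eventually hFe).exists
    exact hn1 hn2
  have hθB : θ ∈ polar (⋃ n, B n) := by
    intro x hx
    obtain ⟨m, hm⟩ := Set.mem_iUnion.1 hx
    exact hclosed _ (isClosed_polar (B m)) (Filter.eventually_atTop.2 ⟨m, fun n hn y hy =>
      (hξB n y (hB.monotone hn hy)).le⟩) x hm
  have hθW : θ ∈ W' := hclosed _ hW'c (Filter.Eventually.of_forall hξW)
  obtain ⟨W₂, hW₂, hW₂L⟩ := key _ (isCompact_polar hV) θ hθV (hWL θ (hWW' hθW) hθB)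
  obtain ⟨n, hn⟩ := (hθ.frequently hW₂).exists
  exact hξL n fun χ hχ => (hW₂L _ hn (hξV n) χ hχ).le

theorem continuous_dualEval_dual [IsTopologicalGroup G] (hB : IsKOmegaExhaustionAtOne B) :
    Continuous (dualEval (PontryaginDual G)) :=
  continuous_dualEval_of_prepolar_mem fun _ hL => hB.prepolar_mem_nhds_one_dual hL

end IsKOmegaExhaustionAtOne

end

/-! ### The locally quasi-convex modification -/

section Lqc

variable {G : Type*} [CommGroup G] [TopologicalSpace G]

/-- Prepolars of compact sets `L` form a basis at `1`, and every `ξ ∈ L` stays continuous for the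
induced topology, so they equal their own bipolars. -/
theorem isLocallyQuasiConvex_induced_dualEval [IsTopologicalGroup G] :
    @IsLocallyQuasiConvex G _ (TopologicalSpace.induced (dualEval G) inferInstance) := by
  rw [@isLocallyQuasiConvex_iff G _ (TopologicalSpace.induced (dualEval G) inferInstance)]
  intro W hW
  rw [nhds_induced, Filter.mem_comap] at hW
  obtain ⟨V, hV, hVW⟩ := hW
  rw [map_one] at hV
  obtain ⟨L, hL, hLV⟩ := exists_polar_subset hV
  refine ⟨prepolar L, ?_, ?_⟩
  · rw [nhds_induced, Filter.mem_comap]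
    exact ⟨polar L, by rw [map_one]; exact polar_mem_nhds_one hL, subset_rfl⟩
  · intro x hx
    refine hVW (hLV fun ξ hξ => ?_)
    have h : Continuous fun χ : PontryaginDual (PontryaginDual G) => χ ξ :=
      map_continuous (dualEval (PontryaginDual G) ξ)
    let ξ' : @PontryaginDual G _ (TopologicalSpace.induced (dualEval G) inferInstance) :=
      @ContinuousMonoidHom.mk G Circle _ _ (TopologicalSpace.induced (dualEval G) inferInstance) _
        (ContinuousMonoidHom.toMonoidHom ξ)
        (@Continuous.comp G _ _ (TopologicalSpace.induced (dualEval G) inferInstance) _ _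
          (dualEval G) (fun χ => χ ξ) h
          (@continuous_induced_dom G _ (dualEval G) _))
    exact hx ξ' fun a ha => ha ξ hξ

variable (G) in
/-- The identity, as a homomorphism from `G` to `(G, 𝒪_lqc)`. -/
def toWithLqcTopology : G →ₜ* WithLqcTopology G where
  toFun x := x
  map_one' := rfl
  map_mul' _ _ := rfl
  continuous_toFun := continuous_id_iff_le.2 (lqcTopology_mem G).1

variable (G) in
/-- The evaluation homomorphism on `(G, 𝒪_lqc)`. -/
noncomputable def WithLqcTopology.dualEval :
    WithLqcTopology G →* PontryaginDual (PontryaginDual G) := _root_.dualEval G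

/-- If the evaluation homomorphism is continuous, then `𝒪_lqc` is the topology induced by it. -/
theorem WithLqcTopology.isInducing_dualEval [IsTopologicalGroup G] (h : Continuous (_root_.dualEval G)) :
    IsInducing (WithLqcTopology.dualEval G) := by
  refine IsTopologicalGroup.isInducing_iff_nhds_one.2 (le_antisymm ?_ fun W hW => ?_)
  · have hc : Continuous (WithLqcTopology.dualEval G) := by
      refine continuous_iff_le_induced.2 (sInf_le ⟨continuous_iff_le_induced.1 h,
        topologicalGroup_induced (_root_.dualEval G), isLocallyQuasiConvex_induced_dualEval⟩)
    have := hc.tendsto 1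
    rw [map_one] at this
    exact this.le_comap
  -- Conversely, the polar of `U` in `G*` is compact, so its polar is a neighbourhood in `G**`. Its
  -- preimage lies in the bipolar of `U`, as characters for `𝒪_lqc` are characters of `G`.
  · obtain ⟨U, hU, hUW⟩ :=
      (isLocallyQuasiConvex_iff (WithLqcTopology G)).1 (lqcTopology_mem G).2.2 W hW
    have hU' : toWithLqcTopology G ⁻¹' U ∈ 𝓝 (1 : G) :=
      (map_continuous (toWithLqcTopology G)).continuousAt (by rwa [map_one])
    refine Filter.mem_comap.2 ⟨_, polar_mem_nhds_one (isCompact_polar hU'), fun x hx => hUW ?_⟩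
    exact fun ξ hξ => hx (PontryaginDual.map (toWithLqcTopology G) ξ) hξ

theorem PontryaginDual.isHomeomorph_map {A B : Type*} [CommGroup A] [TopologicalSpace A]
    [CommGroup B] [TopologicalSpace B] {f : A →ₜ* B} (hf : IsHomeomorph f) :
    IsHomeomorph (PontryaginDual.map f) := by
  let e := hf.homeomorph
  let g : B →ₜ* A :=
    { toFun := e.symm
      map_one' := e.symm_apply_eq.2 (_root_.map_one f).symm
      map_mul' x y := e.symm_apply_eq.2 (by
        change x * y = f (e.symm x * e.symm y)
        rw [_root_.map_mul]
        exact congrArg₂ _ (e.apply_symm_apply x).symm (e.apply_symm_apply y).symm)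
      continuous_toFun := e.symm.continuous }
  refine isHomeomorph_iff_exists_inverse.2 ⟨map_continuous _, PontryaginDual.map g,
    fun ξ => ?_, fun ξ => ?_, map_continuous _⟩
  · ext x : 1
    exact congrArg ξ (e.apply_symm_apply x)
  · ext x : 1
    exact congrArg ξ (e.symm_apply_apply x)

/-- The evaluation homomorphism, as a continuous homomorphism. -/
noncomputable def dualEvalHom (h : Continuous (dualEval G)) :
    G →ₜ* PontryaginDual (PontryaginDual G) := ⟨dualEval G, h⟩

/-- Always `(η_G)* ∘ η_{G*} = id`; if `η_G` is onto, a character of `G**` is determined by its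
values on evaluations, so the inverse is two-sided. -/
theorem isHomeomorph_map_dualEvalHom (h : Continuous (dualEval G))
    (h' : Continuous (dualEval (PontryaginDual G))) (hs : Function.Surjective (dualEval G)) :
    IsHomeomorph (PontryaginDual.map (dualEvalHom h)) := by
  refine isHomeomorph_iff_exists_inverse.2 ⟨map_continuous _, dualEval (PontryaginDual G),
    fun χ => ?_, fun ξ => ?_, h'⟩
  · ext p : 1
    obtain ⟨x, rfl⟩ := hs p
    rfl
  · rfl

/-- The homomorphism `G_lqc → G**` induced by the evaluation homomorphism of `G`. -/
noncomputable def Lqc.evalHom [IsTopologicalGroup G] (h : Continuous (dualEval G)) :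
    Lqc G →ₜ* PontryaginDual (PontryaginDual G) where
  toMonoidHom := QuotientGroup.lift _ (WithLqcTopology.dualEval G) fun x hx => by
    have hc : IsClosed ((WithLqcTopology.dualEval G).ker : Set (WithLqcTopology G)) :=
      isClosed_singleton.preimage (WithLqcTopology.isInducing_dualEval h).continuous
    exact Subgroup.topologicalClosure_minimal _ bot_le hc hx
  continuous_toFun := (WithLqcTopology.isInducing_dualEval h).continuous.quotient_lift _

theorem Lqc.isHomeomorph_evalHom [IsTopologicalGroup G] (h : Continuous (dualEval G))
    (hs : Function.Surjective (dualEval G)) : IsHomeomorph (Lqc.evalHom h) := by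
  have hi := WithLqcTopology.isInducing_dualEval h
  refine ⟨map_continuous _, fun O hO => ?_, ?_, fun p => ?_⟩
  · obtain ⟨O', hO', hOO'⟩ := hi.isOpen_iff.1 (hO.preimage QuotientGroup.continuous_mk)
    convert hO'
    ext p
    constructor
    · rintro ⟨y, hy, rfl⟩
      obtain ⟨x, rfl⟩ := QuotientGroup.mk_surjective y
      exact (Set.ext_iff.1 hOO' x).2 hy
    · intro hp
      obtain ⟨x, rfl⟩ := hs p
      exact ⟨toLqc G x, (Set.ext_iff.1 hOO' x).1 hp, rfl⟩
  · refine (injective_iff_map_eq_one _).2 fun y hy => ?_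
    obtain ⟨x, rfl⟩ := QuotientGroup.mk_surjective y
    refine (QuotientGroup.eq_one_iff x).2 ?_
    change x ∈ closure ((⊥ : Subgroup (WithLqcTopology G)) : Set (WithLqcTopology G))
    rw [hi.closure_eq_preimage_closure_image]
    refine subset_closure ⟨1, rfl, ?_⟩
    rw [map_one]
    exact hy.symm
  · obtain ⟨x, rfl⟩ := hs p
    exact ⟨toLqc G x, rfl⟩

theorem isReflexive_lqc_and_isHomeomorph_map_toLqc [IsTopologicalGroup G] (h : Continuous (dualEval G))
    (h' : Continuous (dualEval (PontryaginDual G))) (hs : Function.Surjective (dualEval G)) :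
    IsReflexive (Lqc G) ∧ IsHomeomorph (PontryaginDual.map (toLqc G)) := by
  have hP := Lqc.isHomeomorph_evalHom h hs
  have hγ : IsHomeomorph (PontryaginDual.map (toLqc G)) := by
    let e := (PontryaginDual.isHomeomorph_map hP).homeomorph
    -- `η_G` factors as `γ` followed by `Lqc.evalHom`; dualising and cancelling the isomorphism
    -- gives `γ*`.
    have : ⇑(PontryaginDual.map (toLqc G)) = PontryaginDual.map (dualEvalHom h) ∘ e.symm := by
      funext ξ
      obtain ⟨χ, rfl⟩ := e.surjective ξ
      rw [Function.comp_apply, e.symm_apply_apply]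
      rfl
    rw [this]
    exact (isHomeomorph_map_dualEvalHom h h' hs).comp e.symm.isHomeomorph
  refine ⟨?_, hγ⟩
  have : ⇑(dualEval (Lqc G)) =
      PontryaginDual.map (PontryaginDual.map (toLqc G)) ∘ Lqc.evalHom h := by
    funext x
    obtain ⟨x, rfl⟩ := QuotientGroup.mk_surjective x
    rfl
  rw [IsReflexive, this]
  exact (PontryaginDual.isHomeomorph_map hγ).comp hP

end Lqc

/-! ### Direct limits of sequences of locally `k_ω` abelian groups -/

open scoped Pointwise in
/-- The smallest sequence of sets `B` such that `1 ∈ B 0` and `B (n + 1)` contains `S n` and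
`B n * B n`. -/
def mulClosureSeq {G : Type*} [CommGroup G] (S : ℕ → Set G) : ℕ → Set G
  | 0 => {1}
  | n + 1 => mulClosureSeq S n * mulClosureSeq S n ∪ S n

section MulClosureSeq

variable {G : Type*} [CommGroup G] (S : ℕ → Set G)

theorem one_mem_mulClosureSeq (n : ℕ) : (1 : G) ∈ mulClosureSeq S n := by
  induction n with
  | zero => exact rfl
  | succ n ih => exact Or.inl ⟨1, ih, 1, ih, mul_one 1⟩

theorem mul_mem_mulClosureSeq {n : ℕ} {x y : G} (hx : x ∈ mulClosureSeq S n)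
    (hy : y ∈ mulClosureSeq S n) : x * y ∈ mulClosureSeq S (n + 1) :=
  Or.inl ⟨x, hx, y, hy, rfl⟩

theorem subset_mulClosureSeq_succ (n : ℕ) : S n ⊆ mulClosureSeq S (n + 1) :=
  fun _ hx => Or.inr hx

theorem monotone_mulClosureSeq : Monotone (mulClosureSeq S) :=
  monotone_nat_of_le_succ fun n x hx => by
    simpa using mul_mem_mulClosureSeq S hx (one_mem_mulClosureSeq S n)

end MulClosureSeq

/-- Each locally `k_ω` group has a neighbourhood of the neutral element which is exhausted by
compact sets. -/
theorem IsLocallyKOmegaSpace.exists_isKOmegaExhaustionAtOne {G : Type*} [CommGroup G]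
    [TopologicalSpace G] (h : IsLocallyKOmegaSpace G) :
    ∃ K : ℕ → Set G, IsKOmegaExhaustionAtOne K := by
  obtain ⟨U, hU, h1, -, K, hKm, hKc, hKU, hK⟩ := h.2 1
  have hUK : (⋃ n, ((↑) : U → G) '' K n) = U := by
    rw [← Set.image_iUnion, hKU, Set.image_univ, Subtype.range_coe]
  refine ⟨fun n => (↑) '' K n, fun m n hmn => Set.image_mono (hKm hmn),
    fun n => (hKc n).image continuous_subtype_val, by rwa [hUK], fun O hO hOK => ?_⟩
  rw [hUK] at hO
  have hO' : IsOpen (((↑) : U → G) ⁻¹' O) := by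
    refine (hK _).2 fun n => ?_
    have hc : Continuous fun x : K n => (⟨x, x, x.2, rfl⟩ : ((↑) : U → G) '' K n) := by fun_prop
    exact (hOK n).preimage hc
  have := hU.isOpenMap_subtype_val _ hO'
  rwa [Subtype.image_preimage_coe, Set.inter_eq_right.2 hO] at this

/-- Choose `x n ∈ K \ B n`. Each tail of this sequence meets every `B m` in a finite set, so the
complements of the tails are open and form an ascending cover of `K`, yet none contains `K`. -/
theorem IsKOmegaExhaustionAtOne.exists_subset_of_isCompact {G : Type*} [CommGroup G]
    [TopologicalSpace G] [T2Space G] {B : ℕ → Set G} (hB : IsKOmegaExhaustionAtOne B) {K : Set G}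
    (hK : IsCompact K) (hKB : K ⊆ ⋃ n, B n) : ∃ n, K ⊆ B n := by
  by_contra! h
  simp only [Set.not_subset] at h
  choose x hxK hxB using h
  let O : ℕ → Set G := fun k => {y | y ∈ ⋃ n, B n ∧ ∀ n ≥ k, y ≠ x n}
  have hO : ∀ k, IsOpen (O k) := by
    refine fun k => hB.isOpen _ (fun y hy => hy.1) fun m => ?_
    have h : IsOpen (⋂ n ∈ Finset.Ico k m, {y : B m | (y : G) ≠ x n}) :=
      isOpen_biInter_finset fun n _ =>
        isOpen_compl_singleton.preimage continuous_subtype_val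
    convert h using 1
    ext y
    simp only [Set.mem_iInter, Finset.mem_Ico]
    refine ⟨fun h n hn => h.2 n hn.1, fun h => ⟨Set.mem_iUnion_of_mem m y.2, fun n hn => ?_⟩⟩
    rcases lt_or_ge n m with hnm | hnm
    · exact h n ⟨hn, hnm⟩
    · exact fun he => hxB n (he ▸ hB.monotone hnm y.2)
  have hOm : Monotone O := fun k l hkl y hy => ⟨hy.1, fun n hn => hy.2 n (hkl.trans hn)⟩
  obtain ⟨k, hk⟩ := hK.elim_directed_cover O hO (fun y hy => by
    obtain ⟨m, hm⟩ := Set.mem_iUnion.1 (hKB hy)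
    exact Set.mem_iUnion.2 ⟨m, hKB hy, fun n hn he => hxB n (he ▸ hB.monotone hn hm)⟩)
    hOm.directed_le
  exact (hk (hxK k)).2 k le_rfl rfl

/-- The group `G`, equipped with the final topology with respect to a sequence of homomorphisms. -/
def WithFinalTopology {A : ℕ → Type u} [∀ n, CommGroup (A n)] [∀ n, TopologicalSpace (A n)]
    {G : Type u} [CommGroup G] [TopologicalSpace G] (_ : ∀ n, A n →ₜ* G) : Type u := G

section FinalTopology

variable {A : ℕ → Type u} [∀ n, CommGroup (A n)] [∀ n, TopologicalSpace (A n)]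
  {i : ∀ m n, m ≤ n → (A m →ₜ* A n)} {G : Type u} [CommGroup G] [TopologicalSpace G]
  {ι : ∀ n, A n →ₜ* G}

namespace WithFinalTopology

instance : CommGroup (WithFinalTopology ι) := inferInstanceAs (CommGroup G)

instance : TopologicalSpace (WithFinalTopology ι) :=
  ⨆ n, TopologicalSpace.coinduced (ι n) inferInstance

theorem isOpen_iff {O : Set (WithFinalTopology ι)} :
    IsOpen O ↔ ∀ n, IsOpen ((ι n : A n → G) ⁻¹' O) := by
  refine isOpen_iSup_iff.trans (forall_congr' fun n => isOpen_coinduced)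

variable (ι) in
/-- The homomorphism `ι n`, with values in the group with the final topology. -/
def of (n : ℕ) : A n →ₜ* WithFinalTopology ι where
  toMonoidHom := (ι n : A n →* G)
  continuous_toFun := continuous_iff_coinduced_le.2 (le_iSup (fun n =>
    TopologicalSpace.coinduced (ι n) inferInstance) n)

variable (ι) in
/-- The identity, as a continuous homomorphism to the given topology. -/
def toOriginal : WithFinalTopology ι →ₜ* G where
  toFun x := x
  map_one' := rfl
  map_mul' _ _ := rfl
  continuous_toFun := continuous_iSup_dom.2 fun n =>
    continuous_coinduced_dom.2 (map_continuous (ι n))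

instance [T2Space G] : T2Space (WithFinalTopology ι) :=
  T2Space.of_injective_continuous (f := toOriginal ι) (fun _ _ h => h) (map_continuous _)

end WithFinalTopology

end FinalTopology

/-! ### The final topology on the limit is a group topology -/

section DirectLimitTopology

variable {A : ℕ → Type u} [∀ n, CommGroup (A n)] [∀ n, TopologicalSpace (A n)]
  {i : ∀ m n, m ≤ n → (A m →ₜ* A n)} {G : Type u} [CommGroup G] [TopologicalSpace G]
  {ι : ∀ n, A n →ₜ* G} {K : ∀ n, ℕ → Set (A n)}

variable (ι K) in
/-- An ascending sequence of compact subsets of the limit, obtained from compact subsets of the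
groups in the direct sequence. -/
def limitExhaustion : ℕ → Set G :=
  mulClosureSeq fun n => ⋃ k ∈ Finset.range (n + 1), ι k '' K k n

theorem image_subset_limitExhaustion (hK : ∀ n, IsKOmegaExhaustionAtOne (K n)) {k m n : ℕ}
    (hk : k < n) (hm : m < n) : ι k '' K k m ⊆ limitExhaustion ι K n := by
  obtain ⟨n, rfl⟩ : ∃ l, n = l + 1 := ⟨n - 1, by omega⟩
  refine (Set.image_mono ((hK k).monotone (Nat.lt_succ_iff.1 hm))).trans
    (Set.Subset.trans ?_ (subset_mulClosureSeq_succ _ n))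
  exact Set.subset_biUnion_of_mem (u := fun k => ι k '' K k n) (Finset.mem_coe.2 (Finset.mem_range.2 hk))

theorem exists_isCompact_image_eq (hι : ∀ m n (h : m ≤ n) (a : A m), ι n (i m n h a) = ι m a)
    {m n : ℕ} (h : m ≤ n) {C : Set (A m)} (hC : IsCompact C) :
    ∃ C' : Set (A n), IsCompact C' ∧ ι n '' C' = ι m '' C := by
  refine ⟨i m n h '' C, hC.image (map_continuous _), ?_⟩
  rw [Set.image_image]
  exact Set.image_congr fun a _ => hι m n h a

theorem exists_isCompact_limitExhaustion_eq [∀ n, IsTopologicalGroup (A n)]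
    (hι : ∀ m n (h : m ≤ n) (a : A m), ι n (i m n h a) = ι m a)
    (hK : ∀ n, IsKOmegaExhaustionAtOne (K n)) (n : ℕ) :
    ∃ C : Set (A n), IsCompact C ∧ ι n '' C = limitExhaustion ι K n := by
  induction n with
  | zero => exact ⟨{1}, isCompact_singleton, by simp [limitExhaustion, mulClosureSeq]⟩
  | succ n ih =>
    obtain ⟨C, hC, hCB⟩ := ih
    obtain ⟨C', hC', hCC'⟩ := exists_isCompact_image_eq (ι := ι) hι n.le_succ hC
    have h : ∀ k ∈ Finset.range (n + 1), ∃ D : Set (A (n + 1)), IsCompact D ∧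
        ι (n + 1) '' D = ι k '' K k n := fun k hk =>
      exists_isCompact_image_eq (ι := ι) hι (Finset.mem_range.1 hk).le ((hK k).isCompact n)
    choose! D hD hDK using h
    open scoped Pointwise in
    refine ⟨C' * C' ∪ ⋃ k ∈ Finset.range (n + 1), D k,
      (hC'.mul hC').union (Finset.isCompact_biUnion _ hD), ?_⟩
    rw [Set.image_union, Set.image_mul, hCC', hCB, Set.image_iUnion₂, Set.iUnion₂_congr hDK]
    rfl

theorem isCompact_limitExhaustion [∀ n, IsTopologicalGroup (A n)]
    (hι : ∀ m n (h : m ≤ n) (a : A m), ι n (i m n h a) = ι m a)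
    (hK : ∀ n, IsKOmegaExhaustionAtOne (K n)) (n : ℕ) : IsCompact (limitExhaustion ι K n) := by
  obtain ⟨C, hC, hCB⟩ := exists_isCompact_limitExhaustion_eq hι hK n
  exact hCB ▸ hC.image (map_continuous _)

/-- A subset of the union of the compact sets is open in the final topology if its intersection
with each of these compact sets is relatively open. -/
theorem isOpen_withFinalTopology_of_limitExhaustion [IsTopologicalGroup G]
    [∀ n, IsTopologicalGroup (A n)] (hK : ∀ n, IsKOmegaExhaustionAtOne (K n)) {O : Set G}
    (hO : O ⊆ ⋃ n, limitExhaustion ι K n)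
    (hOB : ∀ n, IsOpen ((↑) ⁻¹' O : Set (limitExhaustion ι K n))) :
    IsOpen (X := WithFinalTopology ι) O := by
  refine WithFinalTopology.isOpen_iff.2 fun n => isOpen_iff_mem_nhds.2 fun x hx => ?_
  obtain ⟨k, hk⟩ := Set.mem_iUnion.1 (hO hx)
  -- Translate by `x` to use the exhaustion of `A n` at `1`. For fixed `m` all products `ι n (x *
  -- u)` lie in one compact set: the index is the maximum of those of the two factors, plus one.
  have h : IsOpen {u : A n | u ∈ ⋃ m, K n m ∧ ι n (x * u) ∈ O} := by
    refine (hK n).isOpen _ (fun u hu => hu.1) fun m => ?_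
    have hmem : ∀ u : K n m,
        ι n (x * u) ∈ limitExhaustion ι K (max k (max n m + 1) + 1) := fun u => by
      rw [map_mul]
      refine mul_mem_mulClosureSeq _ (monotone_mulClosureSeq _ (le_max_left _ _) hk)
        (image_subset_limitExhaustion hK (k := n) (m := m) ?_ ?_ ⟨u, u.2, rfl⟩) <;> omega
    have hc : Continuous fun u : K n m =>
        (⟨ι n (x * u), hmem u⟩ : limitExhaustion ι K (max k (max n m + 1) + 1)) :=
      ((map_continuous (ι n)).comp (continuous_const.mul continuous_subtype_val)).subtype_mk _
    convert (hOB _).preimage hc using 1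
    ext u
    exact ⟨fun h => h.2, fun h => ⟨Set.mem_iUnion_of_mem m u.2, h⟩⟩
  have h1 : {u : A n | u ∈ ⋃ m, K n m ∧ ι n (x * u) ∈ O} ∈ 𝓝 (x⁻¹ * x) := by
    rw [inv_mul_cancel]
    exact h.mem_nhds ⟨(hK n).one_mem, by rwa [mul_one]⟩
  filter_upwards [(continuous_const_mul x⁻¹).continuousAt.preimage_mem_nhds h1] with y hy
  have := hy.2
  rwa [mul_inv_cancel_left] at this

/-- Each compact set of the exhaustion is a topological quotient of a compact subset of `A n`, the
limit being Hausdorff. -/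
theorem isOpen_limitExhaustion_of_withFinalTopology [∀ n, IsTopologicalGroup (A n)] [T2Space G]
    (hι : ∀ m n (h : m ≤ n) (a : A m), ι n (i m n h a) = ι m a)
    (hK : ∀ n, IsKOmegaExhaustionAtOne (K n)) {O : Set G}
    (hO : IsOpen (X := WithFinalTopology ι) O) (n : ℕ) :
    IsOpen ((↑) ⁻¹' O : Set (limitExhaustion ι K n)) := by
  obtain ⟨C, hC, hCB⟩ := exists_isCompact_limitExhaustion_eq hι hK n
  have := isCompact_iff_compactSpace.1 hC
  let f : C → limitExhaustion ι K n := fun c => ⟨ι n c, hCB ▸ ⟨c, c.2, rfl⟩⟩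
  have hf : Continuous f := ((map_continuous (ι n)).comp continuous_subtype_val).subtype_mk _
  have hfs : Function.Surjective f := by
    rintro ⟨x, hx⟩
    rw [← hCB] at hx
    obtain ⟨c, hc, rfl⟩ := hx
    exact ⟨⟨c, hc⟩, rfl⟩
  rw [← (hf.isClosedMap.isQuotientMap hf hfs).isOpen_preimage]
  exact (WithFinalTopology.isOpen_iff.1 hO n).preimage continuous_subtype_val

/-- Inductive step for the construction of a neighbourhood `V` with `V * V ⊆ O`. -/
theorem exists_isCompact_between_mul_mem [IsTopologicalGroup G] [T2Space G] {B B' : Set G}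
    (hB : IsCompact B) (hBB' : ∀ x ∈ B, ∀ y ∈ B, x * y ∈ B') {O : Set G}
    (hO : IsOpen ((↑) ⁻¹' O : Set B')) {Q : Set G} (hQ : IsCompact Q) (hQB : Q ⊆ B)
    (hQO : ∀ x ∈ Q, ∀ y ∈ Q, x * y ∈ O) :
    ∃ Q' : Set G, IsCompact Q' ∧ Q' ⊆ B ∧ (∀ x ∈ Q', ∀ y ∈ Q', x * y ∈ O) ∧
      ∃ R : Set G, IsOpen R ∧ Q ⊆ R ∧ R ∩ B ⊆ Q' := by
  have := isCompact_iff_compactSpace.1 hB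
  have hn : IsOpen {p : B × B | (p.1 : G) * p.2 ∈ O} := by
    have hc : Continuous fun p : B × B =>
        (⟨p.1 * p.2, hBB' _ p.1.2 _ p.2.2⟩ : B') := by fun_prop
    exact hO.preimage hc
  have hQ' : IsCompact ((↑) ⁻¹' Q : Set B) := (hQ.isClosed.preimage continuous_subtype_val).isCompact
  obtain ⟨u, v, hu, hv, hQu, hQv, huv⟩ := generalized_tube_lemma hQ' hQ' hn
    (fun p hp => hQO _ hp.1 _ hp.2)
  obtain ⟨L, hL, hQL, hLuv⟩ := exists_compact_between hQ' (hu.inter hv) (Set.subset_inter hQu hQv)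
  obtain ⟨R, hR, hRL⟩ := isOpen_induced_iff.1 (isOpen_interior (s := L))
  refine ⟨(↑) '' L, hL.image continuous_subtype_val, Subtype.coe_image_subset _ _, ?_, R, hR, ?_, ?_⟩
  · rintro - ⟨x, hx, rfl⟩ - ⟨y, hy, rfl⟩
    exact huv (Set.mk_mem_prod (hLuv hx).1 (hLuv hy).2)
  · intro x hx
    have : (⟨x, hQB hx⟩ : B) ∈ (↑) ⁻¹' R := hRL ▸ hQL hx
    exact this
  · rintro x ⟨hxR, hxB⟩
    have : (⟨x, hxB⟩ : B) ∈ (↑) ⁻¹' R := hxR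
    rw [hRL] at this
    exact ⟨_, interior_subset this, rfl⟩

/-- `V` is the union of compact sets `Q n ⊆ B n` with `Q n * Q n ⊆ O`, where `Q (n + 1)` contains a
neighbourhood of `Q n` relative to `B (n + 1)`. The latter makes `V` open in each `B m`. -/
theorem exists_isOpen_withFinalTopology_mul_mem [∀ n, IsTopologicalGroup (A n)]
    [IsTopologicalGroup G] [T2Space G]
    (hι : ∀ m n (h : m ≤ n) (a : A m), ι n (i m n h a) = ι m a)
    (hK : ∀ n, IsKOmegaExhaustionAtOne (K n)) {O : Set G}
    (hO : IsOpen (X := WithFinalTopology ι) O) (h1 : 1 ∈ O) :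
    ∃ V : Set G, IsOpen (X := WithFinalTopology ι) V ∧ 1 ∈ V ∧
      ∀ x ∈ V, ∀ y ∈ V, x * y ∈ O := by
  let B := limitExhaustion ι K
  let T (n : ℕ) := {Q : Set G // IsCompact Q ∧ Q ⊆ B n ∧ ∀ x ∈ Q, ∀ y ∈ Q, x * y ∈ O}
  have hmono : Monotone B := monotone_mulClosureSeq _
  have step : ∀ (n : ℕ) (Q : T n), ∃ Q' : T (n + 1), ∃ R : Set G, IsOpen R ∧ Q.1 ⊆ R ∧
      R ∩ B (n + 1) ⊆ Q'.1 := by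
    rintro n ⟨Q, hQ, hQB, hQO⟩
    obtain ⟨Q', h1, h2, h3, h4⟩ := exists_isCompact_between_mul_mem
      (isCompact_limitExhaustion hι hK (n + 1))
      (fun x hx y hy => mul_mem_mulClosureSeq _ hx hy)
      (isOpen_limitExhaustion_of_withFinalTopology hι hK hO (n + 1 + 1)) hQ
      (hQB.trans (hmono n.le_succ)) hQO
    exact ⟨⟨Q', h1, h2, h3⟩, h4⟩
  choose next hnext using step
  let Q : ∀ n, T n := fun n => Nat.rec
    ⟨{1}, isCompact_singleton, subset_rfl, by simpa using h1⟩ (fun n Q => next n Q) n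
  have hQ : ∀ n, ∃ R : Set G, IsOpen R ∧ (Q n).1 ⊆ R ∧ R ∩ B (n + 1) ⊆ (Q (n + 1)).1 :=
    fun n => hnext n (Q n)
  have hQm : Monotone fun n => (Q n).1 := monotone_nat_of_le_succ fun n => by
    obtain ⟨R, -, hR, hR'⟩ := hQ n
    exact fun x hx => hR' ⟨hR hx, hmono n.le_succ ((Q n).2.2.1 hx)⟩
  refine ⟨⋃ n, (Q n).1, isOpen_withFinalTopology_of_limitExhaustion hK
    (Set.iUnion_mono fun n => (Q n).2.2.1) fun m => isOpen_iff_mem_nhds.2 ?_,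
    Set.mem_iUnion_of_mem 0 rfl, ?_⟩
  · rintro ⟨x, hxm⟩ hx
    obtain ⟨k, hk⟩ := Set.mem_iUnion.1 hx
    obtain ⟨R, hRo, hR, hR'⟩ := hQ (max k m)
    filter_upwards [(hRo.preimage continuous_subtype_val).mem_nhds
      (hR (hQm (le_max_left k m) hk))] with y hy
    exact Set.mem_iUnion.2 ⟨max k m + 1, hR' ⟨hy, hmono (by omega) y.2⟩⟩
  · intro x hx y hy
    obtain ⟨k, hk⟩ := Set.mem_iUnion.1 hx
    obtain ⟨l, hl⟩ := Set.mem_iUnion.1 hy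
    exact (Q (max k l)).2.2.2 x (hQm (le_max_left _ _) hk) y (hQm (le_max_right _ _) hl)

theorem isTopologicalGroup_withFinalTopology [∀ n, IsTopologicalGroup (A n)]
    [IsTopologicalGroup G] [T2Space G]
    (hι : ∀ m n (h : m ≤ n) (a : A m), ι n (i m n h a) = ι m a)
    (hs : ∀ g, ∃ n a, ι n a = g) (hK : ∀ n, IsKOmegaExhaustionAtOne (K n)) :
    IsTopologicalGroup (WithFinalTopology ι) := by
  -- Both `x` and the argument can be moved to a common `A (max m n)`, where multiplication is
  -- continuous.
  have hleft : ∀ x : WithFinalTopology ι, Continuous fun y => x * y := by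
    intro x
    obtain ⟨m, b, rfl⟩ := hs x
    refine continuous_def.2 fun O hO => WithFinalTopology.isOpen_iff.2 fun n => ?_
    have h := (WithFinalTopology.isOpen_iff.1 hO (max m n)).preimage
      (f := fun a : A n => i m _ (le_max_left m n) b * i n _ (le_max_right m n) a)
      (continuous_const.mul (map_continuous _))
    convert h using 1
    ext a
    let O' : Set G := O
    change ι m b * ι n a ∈ O' ↔ ι _ (i m _ _ b * i n _ _ a) ∈ O'
    rw [map_mul, hι, hι]
  refine IsTopologicalGroup.of_comm_of_nhds_one ?_ ?_ ?_
  · intro W hW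
    obtain ⟨O, hOW, hO, h1⟩ := mem_nhds_iff.1 hW
    obtain ⟨V, hV, hV1, hVO⟩ := exists_isOpen_withFinalTopology_mul_mem hι hK hO h1
    have hV' : V ∈ 𝓝 (1 : WithFinalTopology ι) := hV.mem_nhds hV1
    refine Filter.mem_map.2 (Filter.mem_of_superset (Filter.prod_mem_prod hV' hV') ?_)
    rintro ⟨x, y⟩ ⟨hx, hy⟩
    exact hOW (hVO x hx y hy)
  · have hinv : Continuous fun x : WithFinalTopology ι => x⁻¹ := by
      refine continuous_def.2 fun O hO => WithFinalTopology.isOpen_iff.2 fun n => ?_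
      convert (WithFinalTopology.isOpen_iff.1 hO n).preimage continuous_inv using 1
      ext a
      let O' : Set G := O
      change (ι n a)⁻¹ ∈ O' ↔ ι n a⁻¹ ∈ O'
      rw [map_inv]
    simpa using hinv.tendsto 1
  · intro x
    let e : WithFinalTopology ι ≃ₜ WithFinalTopology ι :=
      { Equiv.mulLeft x with
        continuous_toFun := hleft x
        continuous_invFun := hleft x⁻¹ }
    have := e.map_nhds_eq 1
    change Filter.map (fun y => x * y) _ = 𝓝 (x * 1) at this
    rw [this, mul_one]

end DirectLimitTopology

/-! ### Topology and compact sets of the direct limit -/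

namespace IsHausdorffDirectLimit

variable {A : ℕ → Type u} [∀ n, CommGroup (A n)] [∀ n, TopologicalSpace (A n)]
  {i : ∀ m n, m ≤ n → (A m →ₜ* A n)} {G : Type u} [CommGroup G] [TopologicalSpace G]
  {ι : ∀ n, A n →ₜ* G}

theorem apply_apply (hG : IsHausdorffDirectLimit i G ι) (m n : ℕ) (h : m ≤ n) (a : A m) :
    ι n (i m n h a) = ι m a :=
  DFunLike.congr_fun (hG.comp_eq m n h) a

theorem hom_ext (hG : IsHausdorffDirectLimit i G ι) {H : Type u} [CommGroup H]
    [TopologicalSpace H] [IsTopologicalGroup H] [T2Space H] {f g : G →ₜ* H}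
    (h : ∀ n a, f (ι n a) = g (ι n a)) : f = g := by
  obtain ⟨φ, -, hφ⟩ := hG.existsUnique_desc H (fun n => g.comp (ι n)) fun m n hmn => by
    ext a
    exact congrArg g (hG.apply_apply m n hmn a)
  exact (hφ f fun n => by ext a; exact h n a).trans (hφ g fun n => rfl).symm

/-- The images form a subgroup with the same cocone; the induced map `G → D` followed by inclusion
is the identity by uniqueness. -/
theorem exists_apply_eq (hG : IsHausdorffDirectLimit i G ι) (g : G) : ∃ n a, ι n a = g := by
  have := hG.isTopologicalGroup
  have := hG.t2Space
  let D : Subgroup G :=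
    { carrier := {g | ∃ n a, ι n a = g}
      one_mem' := ⟨0, 1, map_one _⟩
      mul_mem' := by
        rintro - - ⟨m, a, rfl⟩ ⟨n, b, rfl⟩
        exact ⟨max m n, i m _ (le_max_left m n) a * i n _ (le_max_right m n) b, by
          rw [map_mul, hG.apply_apply, hG.apply_apply]⟩
      inv_mem' := by
        rintro - ⟨m, a, rfl⟩
        exact ⟨m, a⁻¹, map_inv _ _⟩ }
  obtain ⟨φ, hφ, -⟩ := hG.existsUnique_desc D
    (fun n =>
      { toMonoidHom := (ι n : A n →* G).codRestrict D fun a => ⟨n, a, rfl⟩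
        continuous_toFun := (map_continuous (ι n)).subtype_mk _ })
    fun m n h => by
      ext a
      exact hG.apply_apply m n h a
  let inc : D →ₜ* G := ⟨D.subtype, continuous_subtype_val⟩
  have h : inc.comp φ = ContinuousMonoidHom.id G := hG.hom_ext fun n a =>
    congrArg Subtype.val (DFunLike.congr_fun (hφ n) a)
  have hg : (φ g : G) = g := DFunLike.congr_fun h g
  exact hg ▸ (φ g).2

/-- A direct limit of locally `k_ω` groups carries the final topology. -/
theorem isOpen_of_withFinalTopology [∀ n, IsTopologicalGroup (A n)]
    (hG : IsHausdorffDirectLimit i G ι) {K : ∀ n, ℕ → Set (A n)}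
    (hK : ∀ n, IsKOmegaExhaustionAtOne (K n)) {O : Set G}
    (hO : IsOpen (X := WithFinalTopology ι) O) : IsOpen O := by
  have := hG.isTopologicalGroup
  have := hG.t2Space
  have := isTopologicalGroup_withFinalTopology hG.apply_apply hG.exists_apply_eq hK
  obtain ⟨φ, hφ, -⟩ := hG.existsUnique_desc (WithFinalTopology ι) (WithFinalTopology.of ι)
    fun m n h => by
      ext a
      exact hG.apply_apply m n h a
  have h : (WithFinalTopology.toOriginal ι).comp φ = ContinuousMonoidHom.id G :=
    hG.hom_ext fun n a => DFunLike.congr_fun (hφ n) a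
  have h' : ∀ g, φ g = g := fun g => DFunLike.congr_fun h g
  convert hO.preimage (map_continuous φ) using 1
  ext g
  exact Iff.of_eq (congrArg (· ∈ O) (h' g).symm)

theorem isKOmegaExhaustionAtOne [∀ n, IsTopologicalGroup (A n)]
    (hG : IsHausdorffDirectLimit i G ι) {K : ∀ n, ℕ → Set (A n)}
    (hK : ∀ n, IsKOmegaExhaustionAtOne (K n)) :
    IsKOmegaExhaustionAtOne (limitExhaustion ι K) := by
  have := hG.isTopologicalGroup
  exact ⟨monotone_mulClosureSeq _, isCompact_limitExhaustion hG.apply_apply hK,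
    Set.mem_iUnion_of_mem 0 (one_mem_mulClosureSeq _ 0), fun O hO hOB =>
      hG.isOpen_of_withFinalTopology hK (isOpen_withFinalTopology_of_limitExhaustion hK hO hOB)⟩

/-- Each compact subset of the direct limit is contained in the image of a compact subset of one
of the groups in the direct sequence. -/
theorem exists_isCompact_image_eq [∀ n, IsTopologicalGroup (A n)]
    (hG : IsHausdorffDirectLimit i G ι) (hA : ∀ n, IsLocallyKOmegaSpace (A n)) {Z : Set G}
    (hZ : IsCompact Z) : ∃ n, ∃ C : Set (A n), IsCompact C ∧ ι n '' C = Z := by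
  have := hG.isTopologicalGroup
  have := hG.t2Space
  choose K hK using fun n => (hA n).exists_isKOmegaExhaustionAtOne
  have hB := hG.isKOmegaExhaustionAtOne hK
  let B := limitExhaustion ι K
  suffices h : ∃ n, ∃ C : Set (A n), IsCompact C ∧ Z ⊆ ι n '' C by
    obtain ⟨n, C, hC, hZC⟩ := h
    refine ⟨n, C ∩ ι n ⁻¹' Z, hC.inter_right (hZ.isClosed.preimage (map_continuous _)), ?_⟩
    rw [Set.image_inter_preimage, Set.inter_eq_right.2 hZC]
  -- Lifting is a local matter: near `g`, translate by `g⁻¹` into the exhaustion, lift there, and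
  -- translate back by a lift of `g`.
  refine hZ.induction_on (p := fun Y => ∃ n, ∃ C : Set (A n), IsCompact C ∧ Y ⊆ ι n '' C)
    ⟨0, ∅, isCompact_empty, Set.empty_subset _⟩
    (fun Y Y' hYY' ⟨n, C, hC, hYC⟩ => ⟨n, C, hC, hYY'.trans hYC⟩) ?_ fun g _ => ?_
  · rintro Y Y' ⟨m, C, hC, hYC⟩ ⟨n, C', hC', hYC'⟩
    obtain ⟨D, hD, hDC⟩ := _root_.exists_isCompact_image_eq hG.apply_apply (le_max_left m n) hC
    obtain ⟨D', hD', hDC'⟩ := _root_.exists_isCompact_image_eq hG.apply_apply (le_max_right m n) hC'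
    refine ⟨max m n, D ∪ D', hD.union hD', ?_⟩
    rw [Set.image_union, hDC, hDC']
    exact Set.union_subset_union hYC hYC'
  · have hnhds : (fun x => g⁻¹ * x) ⁻¹' (⋃ n, B n) ∈ 𝓝 g :=
      (continuous_const_mul g⁻¹).continuousAt.preimage_mem_nhds (by
        rw [inv_mul_cancel]; exact hB.iUnion_mem_nhds)
    obtain ⟨N, ⟨hN, hNc⟩, hNB⟩ := (closed_nhds_basis g).mem_iff.1 hnhds
    refine ⟨Z ∩ N, Filter.inter_mem self_mem_nhdsWithin (mem_nhdsWithin_of_mem_nhds hN), ?_⟩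
    obtain ⟨m, hm⟩ := hB.exists_subset_of_isCompact
      ((hZ.inter_right hNc).image (continuous_const_mul g⁻¹))
      (Set.image_subset_iff.2 fun x hx => hNB hx.2)
    obtain ⟨C, hC, hCB⟩ := exists_isCompact_limitExhaustion_eq hG.apply_apply hK m
    obtain ⟨k, a, rfl⟩ := hG.exists_apply_eq g
    obtain ⟨D, hD, hDC⟩ := _root_.exists_isCompact_image_eq hG.apply_apply (le_max_left m k) hC
    refine ⟨max m k, (fun d => i k _ (le_max_right m k) a * d) '' D,
      hD.image (continuous_const_mul _), fun x hx => ?_⟩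
    have hx' := hm ⟨x, hx, rfl⟩
    rw [← hCB, ← hDC] at hx'
    obtain ⟨d, hd, hdx⟩ := hx'
    refine ⟨_, ⟨d, hd, rfl⟩, ?_⟩
    dsimp only at hdx ⊢
    rw [map_mul, hG.apply_apply, hdx, mul_inv_cancel_left]

end IsHausdorffDirectLimit

/-! ### Extension of characters -/

/-- A character which is small on the preimage of a neighbourhood of `1` under a homomorphism with
dense image factors through a character of the target. -/
theorem exists_character_comp_eq_of_denseRange {X Y : Type*} [CommGroup X] [CommGroup Y]
    [TopologicalSpace Y] [IsTopologicalGroup Y] (f : X →* Y) (hf : DenseRange f)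
    (χ : X →* Circle) {V : Set Y} (hV : V ∈ 𝓝 (1 : Y))
    (hχ : ∀ x, f x ∈ V → 0 ≤ (χ x : ℂ).re) :
    ∃ χ' : PontryaginDual Y, ∀ x, χ' (f x) = χ x := by
  -- With the induced topology, `χ` becomes continuous by the power criterion and maps the traces of
  -- neighbourhood filters to Cauchy filters, so it extends to `Y`.
  let _ : TopologicalSpace X := TopologicalSpace.induced f inferInstance
  have : IsTopologicalGroup X := topologicalGroup_induced f
  have hd : IsDenseInducing f := ⟨⟨rfl⟩, hf⟩
  have h1 : Filter.Tendsto χ (Filter.comap f (𝓝 1)) (𝓝 1) := by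
    intro W hW
    obtain ⟨m, hm⟩ := Circle.exists_pow_imp_mem hW
    have h : ∀ᶠ y in 𝓝 (1 : Y), ∀ j ∈ Finset.range (m + 1), y ^ 2 ^ j ∈ V := by
      rw [Filter.eventually_all_finset]
      exact fun j _ => (continuous_pow (2 ^ j)).continuousAt.eventually_mem (by simpa using hV)
    refine Filter.mem_map.2 (Filter.mem_of_superset (Filter.preimage_mem_comap h)
      fun x hx => hm _ fun j hj => ?_)
    rw [← map_pow]
    refine hχ _ ?_
    rw [map_pow]
    exact hx j (Finset.mem_range.2 (by omega))
  have hχc : Continuous χ := continuous_of_continuousAt_one χ (by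
    rwa [ContinuousAt, map_one, nhds_induced, map_one])
  have hc : ∀ y, Cauchy (Filter.map χ (Filter.comap f (𝓝 y))) := by
    intro y
    have := hd.comap_nhds_neBot y
    refine ⟨inferInstance, ?_⟩
    rw [uniformity_eq_comap_nhds_one, Filter.prod_map_map_eq, ← Filter.tendsto_iff_comap,
      Filter.tendsto_map'_iff]
    have hdiv : Filter.Tendsto (fun p : X × X => p.2 / p.1)
        (Filter.comap f (𝓝 y) ×ˢ Filter.comap f (𝓝 y)) (Filter.comap f (𝓝 1)) := by
      rw [Filter.tendsto_comap_iff]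
      have h2 := (Filter.tendsto_comap (f := f) (x := 𝓝 y)).comp
        (Filter.tendsto_snd (f := Filter.comap f (𝓝 y)) (g := Filter.comap f (𝓝 y)))
      have h3 := (Filter.tendsto_comap (f := f) (x := 𝓝 y)).comp
        (Filter.tendsto_fst (f := Filter.comap f (𝓝 y)) (g := Filter.comap f (𝓝 y)))
      have h4 := h2.div' h3
      rw [div_self'] at h4
      refine h4.congr fun p => ?_
      simp
    refine (h1.comp hdiv).congr fun p => ?_
    simp
  have hce := IsDenseInducing.continuous_extend_of_cauchy hd hc
  have he : ∀ x, hd.extend χ (f x) = χ x := fun x => hd.extend_eq hχc x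
  refine ⟨(⟨⟨⟨hd.extend χ, ?_⟩, ?_⟩, hce⟩ : Y →ₜ* Circle), he⟩
  · rw [← map_one f, he, map_one]
  · intro y z
    refine hf.induction_on₂ (p := fun y z => hd.extend χ (y * z) = hd.extend χ y * hd.extend χ z)
      ?_ (fun a b => ?_) y z
    · exact isClosed_eq (hce.comp continuous_mul)
        ((hce.comp continuous_fst).mul (hce.comp continuous_snd))
    · rw [← map_mul, he, he, he, map_mul]

theorem exists_map_eq_of_isDuallyEmbedded {A B : Type*} [CommGroup A] [TopologicalSpace A]
    [CommGroup B] [TopologicalSpace B] {f : A →ₜ* B} (hf : IsEmbedding f)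
    (hd : IsDuallyEmbedded (f : A →* B).range) (ξ : PontryaginDual A) :
    ∃ θ : PontryaginDual B, PontryaginDual.map f θ = ξ := by
  let e := MonoidHom.ofInjective (f := (f : A →* B)) hf.injective
  have he : ∀ y, f (e.symm y) = y := fun y => congrArg Subtype.val (e.apply_symm_apply y)
  have hc : Continuous e.symm := hf.isInducing.continuous_iff.2 (by
    convert (continuous_subtype_val : Continuous fun y : (f : A →* B).range => (y : B)) using 1
    funext y
    exact he y)
  obtain ⟨θ, hθ⟩ := hd ((⟨(ContinuousMonoidHom.toMonoidHom ξ).comp e.symm.toMonoidHom,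
    (map_continuous ξ).comp hc⟩ : (f : A →* B).range →ₜ* Circle))
  refine ⟨θ, ?_⟩
  ext a : 1
  exact (hθ (e a)).trans (congrArg ξ (e.symm_apply_apply a))

/-! ### The dual of a direct limit -/

namespace IsHausdorffDirectLimit

variable {A : ℕ → Type u} [∀ n, CommGroup (A n)] [∀ n, TopologicalSpace (A n)]
  {i : ∀ m n, m ≤ n → (A m →ₜ* A n)} {G : Type u} [CommGroup G] [TopologicalSpace G]
  {ι : ∀ n, A n →ₜ* G}

theorem exists_map_eq (hG : IsHausdorffDirectLimit i G ι) (b : ∀ n, PontryaginDual (A n))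
    (hb : ∀ m n (h : m ≤ n), PontryaginDual.map (i m n h) (b n) = b m) :
    ∃ ξ : PontryaginDual G, ∀ n, PontryaginDual.map (ι n) ξ = b n := by
  -- The universal property only tests groups in universe `u`, hence the lifted circle.
  obtain ⟨φ, hφ, -⟩ := hG.existsUnique_desc (ULift.{u} Circle)
    (fun n =>
      { toFun := fun a => ULift.up (b n a)
        map_one' := congrArg ULift.up (map_one (b n))
        map_mul' := fun x y => congrArg ULift.up (map_mul (b n) x y)
        continuous_toFun := continuous_uliftUp.comp (map_continuous (b n)) })
    fun m n h => by
      ext a : 1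
      exact congrArg ULift.up (DFunLike.congr_fun (hb m n h) a)
  refine ⟨({ toFun := fun g => (φ g).down
             map_one' := congrArg ULift.down (map_one φ)
             map_mul' := fun x y => congrArg ULift.down (map_mul φ x y)
             continuous_toFun := continuous_uliftDown.comp (map_continuous φ) } : G →ₜ* Circle),
    fun n => ?_⟩
  ext a : 1
  exact congrArg ULift.down (DFunLike.congr_fun (hφ n) a)

theorem dual_ext (hG : IsHausdorffDirectLimit i G ι) {ξ θ : PontryaginDual G}
    (h : ∀ n, PontryaginDual.map (ι n) ξ = PontryaginDual.map (ι n) θ) : ξ = θ := by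
  ext g : 1
  obtain ⟨n, a, rfl⟩ := hG.exists_apply_eq g
  exact DFunLike.congr_fun (h n) a

theorem map_mem_projectiveLimit (hG : IsHausdorffDirectLimit i G ι) (ξ : PontryaginDual G) :
    (fun n => PontryaginDual.map (ι n) ξ) ∈ projectiveLimit (fun n => PontryaginDual (A n))
      (fun m n h => PontryaginDual.map (i m n h)) := fun m n h => by
  ext a : 1
  exact congrArg ξ (hG.apply_apply m n h a)

/-- The isomorphism from the dual of the direct limit to the projective limit of the duals. -/
noncomputable def dualMulEquiv (hG : IsHausdorffDirectLimit i G ι) :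
    PontryaginDual G ≃* projectiveLimit (fun n => PontryaginDual (A n))
      (fun m n h => PontryaginDual.map (i m n h)) :=
  MulEquiv.ofBijective
    ({ toFun := fun ξ => ⟨_, hG.map_mem_projectiveLimit ξ⟩
       map_one' := rfl
       map_mul' := fun _ _ => rfl } : PontryaginDual G →* _)
    ⟨fun _ _ h => hG.dual_ext fun n => congrFun (congrArg Subtype.val h) n, fun b => by
      obtain ⟨ξ, hξ⟩ := hG.exists_map_eq b.1 b.2
      exact ⟨ξ, Subtype.ext (funext hξ)⟩⟩

/-- The isomorphism from the dual of the direct limit to the projective limit of the duals, as an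
isomorphism of topological groups. -/
noncomputable def dualContinuousMulEquiv [∀ n, IsTopologicalGroup (A n)]
    (hG : IsHausdorffDirectLimit i G ι) (hA : ∀ n, IsLocallyKOmegaSpace (A n)) :
    PontryaginDual G ≃ₜ* projectiveLimit (fun n => PontryaginDual (A n))
      (fun m n h => PontryaginDual.map (i m n h)) where
  toMulEquiv := hG.dualMulEquiv
  continuous_toFun := Continuous.subtype_mk (continuous_pi fun n =>
    map_continuous (PontryaginDual.map (ι n))) _
  continuous_invFun := by
    refine PontryaginDual.isInducing_toContinuousMap.continuous_iff.2
      (ContinuousMap.continuous_compactOpen.2 fun Z hZ U hU => ?_)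
    obtain ⟨n, C, hC, rfl⟩ := hG.exists_isCompact_image_eq hA hZ
    have h : IsOpen {ξ : PontryaginDual (A n) | Set.MapsTo ξ C U} :=
      (ContinuousMap.isOpen_setOfPred_mapsTo hC hU).preimage
        PontryaginDual.isInducing_toContinuousMap.continuous
    have hc : Continuous fun b : projectiveLimit (fun n => PontryaginDual (A n))
        (fun m n h => PontryaginDual.map (i m n h)) => (b : ∀ n, PontryaginDual (A n)) n :=
      (continuous_apply n).comp continuous_subtype_val
    convert h.preimage hc using 1
    ext b
    obtain ⟨ξ, rfl⟩ := hG.dualMulEquiv.surjective b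
    change Set.MapsTo (hG.dualMulEquiv.symm (hG.dualMulEquiv ξ)) _ U ↔
      Set.MapsTo (fun a => ξ (ι n a)) C U
    rw [MulEquiv.symm_apply_apply, Set.mapsTo_image_iff]
    rfl

theorem surjective_dualEval [∀ n, IsTopologicalGroup (A n)] (hG : IsHausdorffDirectLimit i G ι)
    (hA : ∀ n, IsLocallyKOmegaSpace (A n)) (hr : ∀ n, IsReflexive (A n))
    (hd : ∀ n, DenseRange (PontryaginDual.map (ι n))) : Function.Surjective (dualEval G) := by
  have := hG.isTopologicalGroup
  intro χ
  have hW : {ξ : PontryaginDual G | 0 < (χ ξ : ℂ).re} ∈ 𝓝 1 :=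
    (map_continuous χ).continuousAt.preimage_mem_nhds (by
      rw [map_one]; exact Circle.setOf_re_pos_mem_nhds)
  obtain ⟨Z, hZ, hZW⟩ := exists_polar_subset hW
  obtain ⟨n, C, hC, rfl⟩ := hG.exists_isCompact_image_eq hA hZ
  obtain ⟨χ', hχ'⟩ := exists_character_comp_eq_of_denseRange
    (ContinuousMonoidHom.toMonoidHom (PontryaginDual.map (ι n))) (hd n)
    (ContinuousMonoidHom.toMonoidHom χ) (polar_mem_nhds_one hC)
    -- If `ξ ∘ ι n` lies in the polar of `C`, then `ξ` lies in the polar of its image.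
    (fun ξ hξ => le_of_lt (hZW (by rintro - ⟨a, ha, rfl⟩; exact hξ a ha)))
  obtain ⟨x, rfl⟩ := (hr n).surjective χ'
  refine ⟨ι n x, ?_⟩
  ext ξ : 1
  exact hχ' ξ

/-- Restrict the character to the groups below `n`, extend it one step at a time above `n`, and glue
the compatible family. -/
theorem surjective_map (hG : IsHausdorffDirectLimit i G ι)
    (hi : ∀ m n (h : m ≤ n) k (h' : n ≤ k) a, i n k h' (i m n h a) = i m k (h.trans h') a)
    (hi' : ∀ n a, i n n le_rfl a = a)
    (he : ∀ m n (h : m ≤ n), IsEmbedding (i m n h))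
    (hd : ∀ m n (h : m ≤ n), IsDuallyEmbedded (i m n h : A m →* A n).range) (n : ℕ) :
    Function.Surjective (PontryaginDual.map (ι n)) := by
  intro ξ
  choose ext hext using fun m =>
    exists_map_eq_of_isDuallyEmbedded (he m (m + 1) m.le_succ) (hd m (m + 1) m.le_succ)
  let b : ∀ m, PontryaginDual (A m) := fun m =>
    Nat.rec (PontryaginDual.map (i 0 n n.zero_le) ξ)
      (fun m θ => if h : m + 1 ≤ n then PontryaginDual.map (i (m + 1) n h) ξ else ext m θ) m
  have hbs : ∀ m, b (m + 1) =
      if h : m + 1 ≤ n then PontryaginDual.map (i (m + 1) n h) ξ else ext m (b m) := fun m => rfl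
  have hbn : ∀ m (h : m ≤ n), b m = PontryaginDual.map (i m n h) ξ := by
    rintro (_ | m) h
    · rfl
    · rw [hbs, dif_pos h]
  have hb1 : ∀ m, PontryaginDual.map (i m (m + 1) m.le_succ) (b (m + 1)) = b m := by
    intro m
    by_cases h : m + 1 ≤ n
    · rw [hbn _ h, hbn m (m.le_succ.trans h)]
      ext a : 1
      exact congrArg ξ (hi _ _ _ _ _ a)
    · rw [hbs, dif_neg h, hext]
  obtain ⟨θ, hθ⟩ := hG.exists_map_eq b fun m k h => by
    induction k, h using Nat.le_induction with
    | base => ext a : 1; exact congrArg (b m) (hi' m a)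
    | succ k h ih =>
      rw [← ih, ← hb1 k]
      ext a : 1
      exact congrArg (b (k + 1)) (hi m k h (k + 1) k.le_succ a).symm
  refine ⟨θ, ?_⟩
  rw [hθ, hbn n le_rfl]
  ext a : 1
  exact congrArg ξ (hi' n a)

end IsHausdorffDirectLimit

theorem mainTheorem11
    (A : ℕ → Type u) [∀ n, CommGroup (A n)] [∀ n, TopologicalSpace (A n)]
    [∀ n, IsTopologicalGroup (A n)] (hA : ∀ n, IsLocallyKOmegaSpace (A n))
    (i : ∀ m n, m ≤ n → (A m →ₜ* A n)) [DirectedSystem A (fun m n h => i m n h)]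
    (G : Type u) [CommGroup G] [TopologicalSpace G] [IsTopologicalGroup G]
    (ι : ∀ n, A n →ₜ* G) (hG : IsHausdorffDirectLimit i G ι) :
    (∃ e : PontryaginDual G ≃ₜ* projectiveLimit (fun n => PontryaginDual (A n))
        (fun m n h => PontryaginDual.map (i m n h)),
      ∀ (ξ : PontryaginDual G) (n : ℕ),
        (e ξ : ∀ n, PontryaginDual (A n)) n = PontryaginDual.map (ι n) ξ) ∧
    ((∀ n, IsReflexive (A n)) → (∀ n, DenseRange (PontryaginDual.map (ι n))) →
      IsReflexive (Lqc G) ∧ IsHomeomorph (PontryaginDual.map (toLqc G))) ∧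
    ((∀ m n (h : m ≤ n), IsEmbedding (i m n h)) →
      (∀ m n (h : m ≤ n), IsDuallyEmbedded (i m n h : A m →* A n).range) →
      ∀ n, DenseRange (PontryaginDual.map (ι n))) := by
  choose K hK using fun n => (hA n).exists_isKOmegaExhaustionAtOne
  have hB := hG.isKOmegaExhaustionAtOne hK
  refine ⟨⟨hG.dualContinuousMulEquiv hA, fun ξ n => rfl⟩, fun hr hd => ?_, fun he hd n => ?_⟩
  · exact isReflexive_lqc_and_isHomeomorph_map_toLqc hB.continuous_dualEval
      hB.continuous_dualEval_dual (hG.surjective_dualEval hA hr hd)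
  · exact (hG.surjective_map
      (fun m n h k h' a => DirectedSystem.map_map' (f := fun m n h => i m n h) h h' a)
      (fun n a => DirectedSystem.map_self' (f := fun m n h => i m n h) a) he hd n).denseRange
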